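/- Let $S$ be a commutative monoid and let $L_S$ be the first order language with one unary function symbol for each $s\in S$; left $S$-acts are structures of $L_S$ (all structures are nonempty). An element $a$ of an $S$-act $A$ is act-regular if there is a homomorphism of $S$-acts $\varphi: Sa\to S$ with $\varphi(a)a=a$, and $A$ is regular if all its elements are act-regular. Let $\mathfrak R$ be the class of all regular $S$-acts. A primitive formula is a formula $\exists \bar u(\Phi_0\wedge\dots\wedge\Phi_k)$ with all $\Phi_i$ atomic. In a structure $M$, a primitive set is a set of tuples $\Phi(M,\bar a)=\{\bar x\mid M\models\Phi(\bar x,\bar a)\}$ with $\Phi(\bar x,\bar y)$ primitive; $\Phi(M,\bar a)$ and $\Phi(M,\bar b)$ are called primitive copies. A $\Delta$-primitive set is an intersection of a family of primitive sets. A primitive equivalence is an equivalence relation $\alpha$ on a set $\mathrm{dom}(\alpha)$ of $n$-tuples such that the relation $\alpha$ is defined by a primitive formula (parameters allowed). A generalized primitive set is a set $X^*/\alpha=\{\bar x/\alpha\mid \bar x\in X^*\}$, where $X^*$ is $\Delta$-primitive and $\alpha$ is a primitive equivalence with $X^*\subseteq\mathrm{dom}(\alpha)$. An operation $+$ on $X^*/\alpha$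 is defined by a primitive formula if there are a primitive formula $\Phi(\bar x,\bar y,\bar z,\bar u)$ and a tuple $\bar a$ such that $M\models\Phi(\bar x,\bar y,\bar z,\bar a)\iff \bar x/\alpha+\bar y/\alpha=\bar z/\alpha$ for all $\bar x,\bar y,\bar z\in X^*$. A theory $T$ is primitive normal if in every model of $T$ any two primitive copies are equal or disjoint. It is antiadditive if it is primitive normal and in no model of $T$ (in particular in no large saturated model of a completion of $T$) is there an infinite generalized primitive set that is an abelian group under an operation defined by a primitive formula. A class of structures is primitive normal (antiadditive) if its theory, the set of all sentences true in all members of the class, is. Theorem. If $S$ is a commutative monoid and the class $\mathfrak R$ of regular $S$-acts is axiomatizable and primitive normal, then $\mathfrak R$ is antiadditive. -/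

import Mathlib

open FirstOrder FirstOrder.Language CategoryTheory

universe u v w

/-- Conjunctions of finitely many (at least one) atomic formulas. -/
inductive IsAtomicConj {L : FirstOrder.Language.{u, v}} {β : Type w} {k : ℕ} :
    L.BoundedFormula β k → Prop
  | atomic {φ : L.BoundedFormula β k} (h : φ.IsAtomic) : IsAtomicConj φ
  | and {φ ψ : L.BoundedFormula β k} (hφ : IsAtomicConj φ) (hψ : IsAtomicConj ψ) :
      IsAtomicConj (φ ⊓ ψ)

/-- Primitive formulas: `∃ u₁ … ∃ uₖ (Φ₀ ∧ ⋯ ∧ Φₗ)` with all `Φᵢ` atomic. -/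
inductive IsPrimitive {L : FirstOrder.Language.{u, v}} {β : Type w} :
    {k : ℕ} → L.BoundedFormula β k → Prop
  | conj {k : ℕ} {φ : L.BoundedFormula β k} (h : IsAtomicConj φ) : IsPrimitive φ
  | ex {k : ℕ} {φ : L.BoundedFormula β (k + 1)} (h : IsPrimitive φ) : IsPrimitive φ.ex

section PrimitiveSets

variable (L : FirstOrder.Language.{u, v}) {M : Type w} [L.Structure M]

/-- The set `Φ(M, a)` of solutions of `Φ(x, a)` in `M`. -/
def solutionSet {n m : ℕ} (φ : L.Formula (Fin n ⊕ Fin m)) (a : Fin m → M) : Set (Fin n → M) :=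
  {x | φ.Realize (Sum.elim x a)}

/-- `X` is a primitive set: `X = Φ(M, a)` for a primitive formula `Φ(x, y)` and a tuple `a`. -/
def IsPrimitiveSet {n : ℕ} (X : Set (Fin n → M)) : Prop :=
  ∃ (m : ℕ) (φ : L.Formula (Fin n ⊕ Fin m)) (a : Fin m → M),
    IsPrimitive φ ∧ X = solutionSet L φ a

/-- `X` and `Y` are primitive copies: `X = Φ(M, a)` and `Y = Φ(M, b)` for one primitive
formula `Φ(x, y)` and tuples `a`, `b`. -/
def ArePrimitiveCopies {n : ℕ} (X Y : Set (Fin n → M)) : Prop :=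
  ∃ (m : ℕ) (φ : L.Formula (Fin n ⊕ Fin m)) (a b : Fin m → M),
    IsPrimitive φ ∧ X = solutionSet L φ a ∧ Y = solutionSet L φ b

/-- A `Δ`-primitive set is the intersection of a family of primitive sets. -/
def IsDeltaPrimitiveSet {n : ℕ} (X : Set (Fin n → M)) : Prop :=
  ∃ F : Set (Set (Fin n → M)), (∀ Y ∈ F, IsPrimitiveSet L Y) ∧ X = ⋂₀ F

/-- A primitive equivalence on a set of `n`-tuples. The relation `α` is an equivalence on its
domain `{x | α x x}`: a symmetric and transitive relation relates only elements of that set and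
is reflexive on it. The defining primitive formula may contain parameters. -/
def IsPrimitiveEquivalence {n : ℕ} (α : (Fin n → M) → (Fin n → M) → Prop) : Prop :=
  (∀ x y, α x y → α y x) ∧ (∀ x y z, α x y → α y z → α x z) ∧
    ∃ (m : ℕ) (φ : L.Formula ((Fin n ⊕ Fin n) ⊕ Fin m)) (a : Fin m → M),
      IsPrimitive φ ∧ ∀ x y, α x y ↔ φ.Realize (Sum.elim (Sum.elim x y) a)

/-- The domain of an equivalence. -/
def relDomain {n : ℕ} (α : (Fin n → M) → (Fin n → M) → Prop) : Set (Fin n → M) :=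
  {x | α x x}

/-- The `α`-class `x/α`. -/
def relClass {n : ℕ} (α : (Fin n → M) → (Fin n → M) → Prop) (x : Fin n → M) :
    Set (Fin n → M) :=
  {y | α x y}

/-- The set `B/α` of the classes `x/α`, `x ∈ B`. -/
def classesOf {n : ℕ} (B : Set (Fin n → M)) (α : (Fin n → M) → (Fin n → M) → Prop) :
    Set (Set (Fin n → M)) :=
  relClass α '' B

/-- The class `x/α` as an element of `B/α`, for `x ∈ B`. -/
def classOf {n : ℕ} {B : Set (Fin n → M)} (α : (Fin n → M) → (Fin n → M) → Prop)
    {x : Fin n → M} (hx : x ∈ B) : classesOf B α :=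
  ⟨relClass α x, x, hx, rfl⟩

/-- `B` is a basis and `α` a generative equivalence of a generalized primitive set,
which is then `classesOf B α`. -/
def GeneratesGeneralizedPrimitiveSet {n : ℕ} (B : Set (Fin n → M))
    (α : (Fin n → M) → (Fin n → M) → Prop) : Prop :=
  IsDeltaPrimitiveSet L B ∧ IsPrimitiveEquivalence L α ∧ B ⊆ relDomain α

/-- The binary operation `op` on `B/α` is defined by a primitive formula `Φ(x, y, z, a)`:
for `x, y, z ∈ B`, `Φ(x, y, z, a)` holds in `M` iff `op (x/α) (y/α) = z/α`. -/
def IsPrimitivelyDefinedOp {n : ℕ} (B : Set (Fin n → M))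
    (α : (Fin n → M) → (Fin n → M) → Prop)
    (op : classesOf B α → classesOf B α → classesOf B α) : Prop :=
  ∃ (m : ℕ) (φ : L.Formula (((Fin n ⊕ Fin n) ⊕ Fin n) ⊕ Fin m)) (a : Fin m → M),
    IsPrimitive φ ∧ ∀ (x y z : Fin n → M) (hx : x ∈ B) (hy : y ∈ B) (hz : z ∈ B),
      φ.Realize (Sum.elim (Sum.elim (Sum.elim x y) z) a) ↔
        op (classOf α hx) (classOf α hy) = classOf α hz

end PrimitiveSets

section Theories

variable {L : FirstOrder.Language.{u, v}}

/-- Primitive normality: in every model, any two primitive copies are equal or disjoint. -/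
def IsPrimitiveNormal (T : L.Theory) : Prop :=
  ∀ (M : Type w) [L.Structure M] [Nonempty M], M ⊨ T →
    ∀ (n : ℕ) (X Y : Set (Fin n → M)), ArePrimitiveCopies L X Y → X = Y ∨ X ∩ Y = ∅

/-- Antiadditivity: the theory is primitive normal and in no model of it (in particular in no
large saturated model of a completion of it) is there an infinite generalized primitive set which
is an abelian group under an operation defined by a primitive formula. -/
def IsAntiadditive (T : L.Theory) : Prop :=
  IsPrimitiveNormal.{u, v, w} T ∧
    ∀ (M : Type w) [L.Structure M] [Nonempty M], M ⊨ T →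
      ¬ ∃ (n : ℕ) (B : Set (Fin n → M)) (α : (Fin n → M) → (Fin n → M) → Prop),
        GeneratesGeneralizedPrimitiveSet L B α ∧ (classesOf B α).Infinite ∧
          ∃ _ : AddCommGroup (classesOf B α), IsPrimitivelyDefinedOp L B α (fun p q => p + q)

/-- The class `K` consists of the (nonempty) models of some first order theory. -/
def IsAxiomatizableClass (K : Set (Bundled.{w} L.Structure)) : Prop :=
  ∃ T : L.Theory, ∀ M : Bundled.{w} L.Structure, M ∈ K ↔ Nonempty M ∧ M ⊨ T

/-- The theory of a class: all sentences that hold in every member of the class. -/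
def theoryOfClass (K : Set (Bundled.{w} L.Structure)) : L.Theory :=
  {σ | ∀ M ∈ K, M ⊨ σ}

/-- A class is primitive normal if its theory is. -/
def IsPrimitiveNormalClass (K : Set (Bundled.{w} L.Structure)) : Prop :=
  IsPrimitiveNormal.{u, v, w} (theoryOfClass K)

/-- A class is antiadditive if its theory is. -/
def IsAntiadditiveClass (K : Set (Bundled.{w} L.Structure)) : Prop :=
  IsAntiadditive.{u, v, w} (theoryOfClass K)

end Theories

section Acts

/-- The function symbols of the language of `S`-acts: a unary symbol for each `s : S`. -/
inductive ActFunctions (S : Type u) : ℕ → Type u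
  | smul (s : S) : ActFunctions S 1

/-- The language of `S`-acts. -/
def actLanguage (S : Type u) : FirstOrder.Language.{u, 0} :=
  ⟨ActFunctions S, fun _ => Empty⟩

/-- The unary function symbol of `s : S`. -/
def actSymbol {S : Type u} (s : S) : (actLanguage S).Functions 1 :=
  ActFunctions.smul s

/-- The element `a` of the left `S`-act `A` is act-regular: there is a homomorphism of
`S`-acts `φ : Sa → S` with `φ(a) a = a`. Here `MulAction.orbit S a` is the subact `Sa`. -/
def IsActRegular (S : Type u) [Monoid S] {A : Type w} [MulAction S A] (a : A) : Prop :=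
  ∃ φ : MulAction.orbit S a →[S] S, φ ⟨a, MulAction.mem_orbit_self a⟩ • a = a

/-- The class of regular `S`-acts: the nonempty structures of the language of `S`-acts in which
the symbols are interpreted by a left action of `S`, with all elements act-regular. -/
def regularActs (S : Type u) [Monoid S] : Set (Bundled.{w} (actLanguage S).Structure) :=
  {A | Nonempty A ∧ ∃ _ : MulAction S A,
    (∀ (s : S) (a : A), Structure.funMap (actSymbol s) ![a] = s • a) ∧
      ∀ a : A, IsActRegular S a}

end Acts

/-! ### Regular acts with uniserial orbits: the equivariant majority operation. -/

section Regular

variable {S : Type u} [CommMonoid S] {A : Type w} [MulAction S A]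

/-! A majority operation commuting with `S` preserves all primitive formulas, and fixes their
parameters because it is idempotent. Applied coordinatewise to `0 + x = x`, `x + 0 = x`, `0 + 0 = 0`
it yields `0 + 0 = x`, so a primitively defined group is trivial
(`IsTernaryPolymorphism.subsingleton_of_isPrimitivelyDefinedOp`).

Such an operation exists on every model. Axiomatizability makes models regular acts, and primitive
normality forces the cyclic subacts of each `Sa` to form a chain
(`hasUniserialOrbits_of_isPrimitiveNormalClass`). The sets `E x y` then measure closeness like an
ultrametric: some two of any three points form a closest pair, and `majority` returns the first of
these, multiplied by the idempotent of the second. The main work is equivariance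
(`IsIdempotentChoice.majority_smul`). -/

theorem isActRegular_iff {a : A} :
    IsActRegular S a ↔ ∃ e : S, e • a = a ∧ ∀ s t : S, s • a = t • a → s * e = t * e := by
  constructor
  · rintro ⟨φ, hφ⟩
    refine ⟨_, hφ, fun s t h => ?_⟩
    rw [← smul_eq_mul, ← smul_eq_mul, ← map_smul φ, ← map_smul φ]
    exact congrArg φ (Subtype.ext h)
  · rintro ⟨e, he, h⟩
    have hc (b : MulAction.orbit S a) : b.2.choose • a = b.1 := b.2.choose_spec
    refine ⟨⟨fun b => b.2.choose * e, fun s b => ?_⟩, ?_⟩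
    · have : (s • b).2.choose • a = (s * b.2.choose) • a := by
        rw [hc, mul_smul, hc]; rfl
      simpa [mul_assoc] using h _ _ this
    · change ((⟨a, MulAction.mem_orbit_self a⟩ : MulAction.orbit S a).2.choose * e) • a = a
      rw [mul_smul, he, hc]

/-- Every cyclic subact is a chain of cyclic subacts. -/
def HasUniserialOrbits (S : Type u) [CommMonoid S] (A : Type w) [MulAction S A] : Prop :=
  ∀ (a : A) (s t : S), (∃ r : S, s • a = r • t • a) ∨ ∃ r : S, t • a = r • s • a

/-- The elements `s • x = s • y`. -/
def equalizedElements (S : Type u) [CommMonoid S] {A : Type w} [MulAction S A] (x y : A) :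
    Set A :=
  {p | ∃ s : S, s • x = p ∧ s • y = p}

local notation "E" => equalizedElements S

variable (S) in
theorem equalizedElements_comm (x y : A) : E x y = E y x := by
  ext p
  exact exists_congr fun s => and_comm

theorem smul_mem_equalizedElements {x y p : A} (r : S) (h : p ∈ E x y) : r • p ∈ E x y := by
  obtain ⟨s, rfl, hs⟩ := h
  exact ⟨r * s, mul_smul .., by rw [mul_smul, hs]⟩

theorem mem_equalizedElements_of_smul {x y p : A} {s : S} (h : p ∈ E (s • x) (s • y)) :
    p ∈ E x y := by
  obtain ⟨r, rfl, hr⟩ := h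
  exact ⟨r * s, mul_smul .., by rw [mul_smul, hr]⟩

/-- A choice of the idempotents `e x` with `S x ≅ S (e x)`. -/
structure IsIdempotentChoice (e : A → S) : Prop where
  smul_self : ∀ x, e x • x = x
  mul_eq : ∀ (x : A) (s t : S), s • x = t • x → s * e x = t * e x

variable {e : A → S}

theorem IsIdempotentChoice.mul_of_smul_self (he : IsIdempotentChoice e) {x : A} {s : S}
    (h : s • x = x) : s * e x = e x := by
  simpa using he.mul_eq x s 1 (by simpa using h)

theorem IsIdempotentChoice.smul_smul_self (he : IsIdempotentChoice e) (x : A) (s : S) :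
    e x • s • x = s • x := by
  rw [smul_comm, he.smul_self]

theorem IsIdempotentChoice.smul_of_mem_left (he : IsIdempotentChoice e) {x y p : A}
    (h : p ∈ E x y) : e x • p = p := by
  obtain ⟨s, rfl, -⟩ := h
  exact he.smul_smul_self x s

theorem IsIdempotentChoice.smul_of_mem_right (he : IsIdempotentChoice e) {x y p : A}
    (h : p ∈ E x y) : e y • p = p :=
  he.smul_of_mem_left (equalizedElements_comm S x y ▸ h)

/-- The multiplier `r` need not equalize `x` and `y`; multiplying it by `e x` makes it agree with
one that does. -/
theorem IsIdempotentChoice.smul_smul_eq_of_mem (he : IsIdempotentChoice e) {x y p : A} {r : S}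
    (h : p ∈ E x y) (hr : r • x = p) : r • e x • y = p := by
  have hp := he.smul_of_mem_left h
  obtain ⟨t, ht, ht'⟩ := h
  rw [← mul_smul, he.mul_eq x r t (hr.trans ht.symm), mul_comm, mul_smul, ht', hp]

/-- The ultrametric inequality for closeness. -/
theorem IsIdempotentChoice.mem_trans (he : IsIdempotentChoice e) {x y z p : A}
    (h : p ∈ E x y) (h' : p ∈ E y z) : p ∈ E x z := by
  have hp := he.smul_of_mem_right h
  obtain ⟨s, hs, hs'⟩ := h'
  rw [equalizedElements_comm] at h
  refine ⟨s * e y, ?_, ?_⟩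
  · rw [mul_smul, he.smul_smul_eq_of_mem h hs]
  · rw [mul_comm, mul_smul, hs', hp]

/-- Multiplying by `s` loses no common value that is still a multiple of `s • x`; hence closest
pairs stay closest. -/
theorem IsIdempotentChoice.mem_smul_left (he : IsIdempotentChoice e) {x y p : A} {r s : S}
    (h : p ∈ E x y) (hr : r • s • x = p) : p ∈ E (s • x) (s • y) := by
  have hp := he.smul_of_mem_left h
  refine ⟨e x * r, by rw [mul_smul, hr, hp], ?_⟩
  rw [← he.smul_smul_eq_of_mem h (by rw [mul_smul, hr] : (r * s) • x = p)]
  simp only [← mul_smul]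
  congr 1
  ac_rfl

theorem IsIdempotentChoice.mem_smul_right (he : IsIdempotentChoice e) {x y p : A} {r s : S}
    (h : p ∈ E x y) (hr : r • s • y = p) : p ∈ E (s • x) (s • y) := by
  rw [equalizedElements_comm] at h ⊢
  exact he.mem_smul_left h hr

theorem IsIdempotentChoice.smul_equivariant (he : IsIdempotentChoice e) (x y : A) (s : S) :
    e (s • y) • s • x = s • e y • x := by
  have h1 : e y * e (s • y) = e (s • y) := he.mul_of_smul_self (he.smul_smul_self y s)
  have h2 : e (s • y) * s * e y = s * e y :=
    he.mul_eq y _ _ (by rw [mul_smul, he.smul_self])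
  rw [← h1, ← mul_smul, ← mul_smul, ← h2]
  congr 1
  ac_rfl

theorem HasUniserialOrbits.subset (hu : HasUniserialOrbits S A) {x y z p : A}
    (h : p ∈ E x y) (h' : p ∉ E x z) : E x z ⊆ E x y := by
  rintro q hq
  obtain ⟨s, hs, -⟩ := id h
  obtain ⟨t, ht, -⟩ := id hq
  obtain ⟨r, hr⟩ | ⟨r, hr⟩ := hu x s t
  · rw [hs, ht] at hr
    exact absurd (hr ▸ smul_mem_equalizedElements r hq) h'
  · rw [hs, ht] at hr
    exact hr ▸ smul_mem_equalizedElements r h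

theorem HasUniserialOrbits.subset' (hu : HasUniserialOrbits S A) {x y z p : A}
    (h : p ∈ E x y) (h' : p ∉ E z y) : E z y ⊆ E x y := by
  rw [equalizedElements_comm S x y] at h ⊢
  rw [equalizedElements_comm S z y] at h' ⊢
  exact hu.subset h h'

variable (S) in
/-- The pair `x, y` is at least as close together as the pairs `y, z` and `x, z`. -/
def IsClosestPair (x y z : A) : Prop :=
  E y z ⊆ E x y ∧ E x z ⊆ E x y

theorem IsIdempotentChoice.isClosestPair_smul (he : IsIdempotentChoice e) {x y z : A} (s : S)
    (h : IsClosestPair S x y z) : IsClosestPair S (s • x) (s • y) (s • z) := by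
  constructor
  · intro p hp
    obtain ⟨r, hr, -⟩ := id hp
    exact he.mem_smul_right (h.1 (mem_equalizedElements_of_smul hp)) hr
  · intro p hp
    obtain ⟨r, hr, -⟩ := id hp
    exact he.mem_smul_left (h.2 (mem_equalizedElements_of_smul hp)) hr

theorem IsIdempotentChoice.exists_mem_of_not_isClosestPair (he : IsIdempotentChoice e)
    (hu : HasUniserialOrbits S A) {x y z : A} (hA : ¬ IsClosestPair S x y z)
    (hB : ¬ IsClosestPair S x z y) : ∃ p ∈ E y z, p ∉ E x y ∧ p ∉ E x z := by
  have key : ∃ p ∈ E y z, p ∉ E x y := by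
    by_contra! hyz
    have hxz : ¬ E x z ⊆ E x y := fun h => hA ⟨hyz, h⟩
    obtain ⟨p, hp, hp'⟩ := Set.not_subset.1 hxz
    have h1 := hu.subset hp hp'
    refine hB ⟨?_, h1⟩
    rw [equalizedElements_comm S z y]
    exact fun q hq => h1 (hyz q hq)
  obtain ⟨p, hp, hp'⟩ := key
  refine ⟨p, hp, hp', fun h => hp' (he.mem_trans h ?_)⟩
  rwa [equalizedElements_comm]

open Classical in
/-- An equivariant majority operation on regular acts with uniserial orbits. -/
noncomputable def majority (e : A → S) (x y z : A) : A :=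
  if IsClosestPair S x y z then e y • x else if IsClosestPair S x z y then e z • x else e z • y

theorem self_mem_equalizedElements (x : A) : x ∈ E x x :=
  ⟨1, one_smul .., one_smul ..⟩

theorem equalizedElements_subset_self (x y : A) : E x y ⊆ E x x := by
  rintro p ⟨s, hs, -⟩
  exact ⟨s, hs, hs⟩

theorem IsIdempotentChoice.majority_left (he : IsIdempotentChoice e) (x y : A) :
    majority e x x y = x := by
  rw [majority, if_pos ⟨equalizedElements_subset_self x y, equalizedElements_subset_self x y⟩,
    he.smul_self]

theorem IsIdempotentChoice.majority_outer (he : IsIdempotentChoice e) (x y : A) :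
    majority e x y x = x := by
  unfold majority
  split_ifs with hA hB
  · exact he.smul_of_mem_right (hA.2 (self_mem_equalizedElements x))
  · exact he.smul_self x
  · refine absurd ⟨?_, equalizedElements_subset_self x y⟩ hB
    exact equalizedElements_subset_self x y

theorem IsIdempotentChoice.majority_right (he : IsIdempotentChoice e) (x y : A) :
    majority e y x x = x := by
  unfold majority
  split_ifs with hA
  · have h := hA.1 (self_mem_equalizedElements x)
    rw [equalizedElements_comm] at h
    simpa using he.smul_smul_eq_of_mem h (one_smul S x)
  · exact he.smul_self x

theorem IsIdempotentChoice.majority_smul (he : IsIdempotentChoice e)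
    (hu : HasUniserialOrbits S A) (s : S) (x y z : A) :
    majority e (s • x) (s • y) (s • z) = s • majority e x y z := by
  by_cases hA : IsClosestPair S x y z
  · rw [majority, majority, if_pos hA, if_pos (he.isClosestPair_smul s hA), he.smul_equivariant]
  by_cases hB : IsClosestPair S x z y
  · rw [majority, majority, if_neg hA, if_pos hB]
    by_cases hA' : IsClosestPair S (s • x) (s • y) (s • z)
    · rw [if_pos hA']
      -- Multiplication by `s` has created a tie. This happens only when `s • x` already lies in `E
      -- x z`, and then both formulas give `s • x`.
      have hxz : ¬ E x z ⊆ E x y := fun h =>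
        hA ⟨fun p hp => h (hB.1 (equalizedElements_comm S y z ▸ hp)), h⟩
      obtain ⟨p, hp, hp'⟩ := Set.not_subset.1 hxz
      obtain ⟨t, ht, -⟩ := id hp
      obtain ⟨r, hr⟩ | ⟨r, hr⟩ := hu x t s
      · refine absurd (mem_equalizedElements_of_smul (hA'.2 ?_)) hp'
        exact he.mem_smul_left hp (hr.symm.trans ht)
      · have h1 : s • x ∈ E x z := by
          rw [hr, ht]
          exact smul_mem_equalizedElements r hp
        have h2 := hA'.2 (he.mem_smul_left h1 (one_smul S _))
        rw [he.smul_of_mem_right h2, smul_comm, he.smul_of_mem_right h1]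
    · rw [if_neg hA', if_pos (he.isClosestPair_smul s hB), he.smul_equivariant]
  · obtain ⟨p, hp, hxy, hxz⟩ := he.exists_mem_of_not_isClosestPair hu hA hB
    -- If `x, z` becomes closest, so does `x, y`, which is tested before it; only one kind of tie
    -- remains.
    have hBA : IsClosestPair S (s • x) (s • z) (s • y) →
        IsClosestPair S (s • x) (s • y) (s • z) := by
      intro h
      have h3 : E (s • x) (s • z) ⊆ E (s • x) (s • y) := by
        intro q hq
        obtain ⟨r, -, hr⟩ := id hq
        have h4 := he.mem_smul_right (hu.subset' hp hxz (mem_equalizedElements_of_smul hq)) hr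
        exact he.mem_trans hq (equalizedElements_comm S (s • y) (s • z) ▸ h4)
      exact ⟨fun q hq => h3 (h.1 (equalizedElements_comm S (s • y) (s • z) ▸ hq)), h3⟩
    rw [majority, majority, if_neg hA, if_neg hB]
    by_cases hA' : IsClosestPair S (s • x) (s • y) (s • z)
    · rw [if_pos hA']
      obtain ⟨t, ht, -⟩ := id hp
      obtain ⟨r, hr⟩ | ⟨r, hr⟩ := hu y t s
      · refine absurd (mem_equalizedElements_of_smul (hA'.1 ?_)) hxy
        exact he.mem_smul_left hp (hr.symm.trans ht)
      · have h1 : s • y ∈ E y z := by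
          rw [hr, ht]
          exact smul_mem_equalizedElements r hp
        have h2 := hA'.1 (he.mem_smul_left h1 (one_smul S _))
        rw [equalizedElements_comm] at h2
        rw [smul_comm s, he.smul_of_mem_right h1]
        simpa using he.smul_smul_eq_of_mem h2 (one_smul S _)
    · rw [if_neg hA', if_neg (mt hBA hA'), he.smul_equivariant]

end Regular

/-! ### Primitive normality forces uniserial orbits. -/

section Amalgam

variable {S : Type u} [CommMonoid S] {A : Type w} [MulAction S A]

/-- Three copies of `A` (marked by two flags), the second glued to the first along `S j` and the
third glued to the first along `S k`. -/
def TripleAmalgam (S : Type u) [CommMonoid S] {A : Type w} [MulAction S A] (j k : A) : Type w :=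
  {p : A × Prop × Prop // (p.2.1 → p.1 ∉ MulAction.orbit S j) ∧
    (p.2.2 → p.1 ∉ MulAction.orbit S k) ∧ ¬ (p.2.1 ∧ p.2.2)}

theorem smul_mem_orbit {j x : A} (s : S) (h : x ∈ MulAction.orbit S j) :
    s • x ∈ MulAction.orbit S j := by
  obtain ⟨r, rfl⟩ := h
  exact ⟨s * r, mul_smul ..⟩

/-- A flag is dropped once the element enters the orbit along which its copy is glued. -/
instance (j k : A) : MulAction S (TripleAmalgam S j k) where
  smul s p := ⟨(s • p.1.1, p.1.2.1 ∧ s • p.1.1 ∉ MulAction.orbit S j,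
    p.1.2.2 ∧ s • p.1.1 ∉ MulAction.orbit S k), And.right, And.right,
    fun h => p.2.2.2 ⟨h.1.1, h.2.1⟩⟩
  one_smul p := by
    obtain ⟨⟨x, P, Q⟩, hP, hQ, hPQ⟩ := p
    refine Subtype.ext (Prod.ext (one_smul S x) (Prod.ext ?_ ?_))
    · exact propext ⟨And.left, fun h => ⟨h, (one_smul S x).symm ▸ hP h⟩⟩
    · exact propext ⟨And.left, fun h => ⟨h, (one_smul S x).symm ▸ hQ h⟩⟩
  mul_smul s t p := by
    obtain ⟨⟨x, P, Q⟩, hP, hQ, hPQ⟩ := p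
    refine Subtype.ext (Prod.ext (mul_smul s t x) (Prod.ext ?_ ?_))
    · refine propext ⟨fun h => ⟨⟨h.1, fun h' => h.2 ?_⟩, fun h' => h.2 ?_⟩,
        fun h => ⟨h.1.1, fun h' => h.2 ?_⟩⟩
      · exact mul_smul s t x ▸ smul_mem_orbit s h'
      · exact mul_smul s t x ▸ h'
      · exact mul_smul s t x ▸ h'
    · refine propext ⟨fun h => ⟨⟨h.1, fun h' => h.2 ?_⟩, fun h' => h.2 ?_⟩,
        fun h => ⟨h.1.1, fun h' => h.2 ?_⟩⟩
      · exact mul_smul s t x ▸ smul_mem_orbit s h'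
      · exact mul_smul s t x ▸ h'
      · exact mul_smul s t x ▸ h'

theorem TripleAmalgam.isActRegular (hA : ∀ a : A, IsActRegular S a) {j k : A}
    (p : TripleAmalgam S j k) : IsActRegular S p := by
  obtain ⟨e, he, h⟩ := isActRegular_iff.1 (hA p.1.1)
  refine isActRegular_iff.2 ⟨e, ?_, fun s t hst => h s t (congrArg (·.1.1) hst)⟩
  obtain ⟨⟨x, P, Q⟩, hP, hQ, hPQ⟩ := p
  refine Subtype.ext (Prod.ext he (Prod.ext ?_ ?_))
  · exact propext ⟨And.left, fun h' => ⟨h', fun hx => hP h' (he ▸ hx)⟩⟩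
  · exact propext ⟨And.left, fun h' => ⟨h', fun hx => hQ h' (he ▸ hx)⟩⟩

/-- An act as a structure of the language of acts. -/
@[reducible] def actStructure (S : Type u) [Monoid S] (A : Type w) [MulAction S A] :
    (actLanguage S).Structure A where
  funMap | .smul s => fun v => s • v 0
  RelMap r := nomatch r

/-- The formula `∃ u, x = s u ∧ y = t u`. -/
def commonRootFormula {S : Type u} (s t : S) : (actLanguage S).Formula (Fin 1 ⊕ Fin 1) :=
  BoundedFormula.ex
    (((Term.var (.inl (.inl 0))).bdEqual ((actSymbol s).apply₁ (Term.var (.inr 0)))) ⊓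
      ((Term.var (.inl (.inr 0))).bdEqual ((actSymbol t).apply₁ (Term.var (.inr 0)))))

theorem isPrimitive_commonRootFormula {S : Type u} (s t : S) :
    IsPrimitive (commonRootFormula s t) :=
  .ex (.conj (.and (.atomic (.equal _ _)) (.atomic (.equal _ _))))

theorem realize_commonRootFormula [(actLanguage S).Structure A]
    (hs : ∀ (s : S) (a : A), Structure.funMap (actSymbol s) ![a] = s • a) (s t : S)
    (x y : Fin 1 → A) : (commonRootFormula s t).Realize (Sum.elim x y) ↔
      ∃ u : A, x 0 = s • u ∧ y 0 = t • u := by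
  simp [commonRootFormula, Formula.Realize, Term.realize_functions_apply₁, hs, Fin.snoc]

/-- If neither of `s • a`, `t • a` is a multiple of the other, the amalgam along their orbits has
two primitive copies that meet but differ. -/
theorem hasUniserialOrbits_of_isPrimitiveNormalClass {A : Type u} [MulAction S A]
    (hA : ∀ a : A, IsActRegular S a) (hpn : IsPrimitiveNormalClass (regularActs.{u, u} S)) :
    HasUniserialOrbits S A := by
  intro a s t
  let N := TripleAmalgam S (s • a) (t • a)
  let J := MulAction.orbit S (s • a)
  let K := MulAction.orbit S (t • a)
  let _ := actStructure S N
  have hs (r : S) (p : N) : Structure.funMap (actSymbol r) ![p] = r • p := rfl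
  let a₁ : N := ⟨(a, False, False), False.elim, False.elim, fun h => h.1⟩
  let a₂ : N := ⟨(a, a ∉ J, False), id, False.elim, fun h => h.2⟩
  let a₃ : N := ⟨(a, False, a ∉ K), False.elim, id, fun h => h.1⟩
  have : Nonempty N := ⟨a₁⟩
  have hN : N ⊨ theoryOfClass (regularActs.{u, u} S) :=
    ⟨fun σ hσ => hσ ⟨N, inferInstance⟩ ⟨‹_›, inferInstance, hs, TripleAmalgam.isActRegular hA⟩⟩
  have hsa : s • a ∈ J := MulAction.mem_orbit_self _
  have hta : t • a ∈ K := MulAction.mem_orbit_self _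
  have h12 : s • a₁ = s • a₂ := Subtype.ext <| Prod.ext rfl <| Prod.ext
    (propext ⟨fun h => h.1.elim, fun h => (h.2 hsa).elim⟩) rfl
  have h13 : t • a₁ = t • a₃ := Subtype.ext <| Prod.ext rfl <| Prod.ext rfl
    (propext ⟨fun h => h.1.elim, fun h => (h.2 hta).elim⟩)
  have mem (p q : N) : (fun _ => p) ∈ solutionSet (actLanguage S) (commonRootFormula s t)
      (fun _ : Fin 1 => q) ↔ ∃ u : N, p = s • u ∧ q = t • u :=
    realize_commonRootFormula hs s t _ _
  have hcopies := hpn N hN 1 _ _ ⟨1, commonRootFormula s t, fun _ => t • a₁, fun _ => t • a₂,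
    isPrimitive_commonRootFormula s t, rfl, rfl⟩
  -- The copies share `s • a₁ = s • a₂`.
  have heq := hcopies.resolve_right fun h => by
    have : (fun _ => s • a₁) ∈ (∅ : Set (Fin 1 → N)) :=
      h ▸ ⟨(mem _ _).2 ⟨a₁, rfl, rfl⟩, (mem _ _).2 ⟨a₂, h12, rfl⟩⟩
    exact this
  -- As `t • a₃ = t • a₁`, the first copy contains `s • a₃`, hence so does the second. The resulting
  -- root `u` would have to carry both flags.
  obtain ⟨u, hu, hu'⟩ := (mem (s • a₃) (t • a₂)).1 (heq ▸ (mem _ _).2 ⟨a₃, rfl, h13⟩)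
  by_contra! hcon
  have hsK : s • a ∉ K := fun ⟨r, hr⟩ => hcon.1 r hr.symm
  have htJ : t • a ∉ J := fun ⟨r, hr⟩ => hcon.2 r hr.symm
  have haK : a ∉ K := fun h => hsK (smul_mem_orbit s h)
  have haJ : a ∉ J := fun h => htJ (smul_mem_orbit t h)
  have h1 : u.1.2.2 := ((congrArg (fun p : N => p.1.2.2) hu).mp ⟨haK, hsK⟩).1
  have h2 : u.1.2.1 := ((congrArg (fun p : N => p.1.2.1) hu').mp ⟨haJ, htJ⟩).1
  exact u.2.2.2 ⟨h2, h1⟩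

end Amalgam

/-! ### Polymorphisms and primitively defined groups. -/

section Polymorphism

variable {S : Type u} {A : Type w} [(actLanguage S).Structure A] {m : A → A → A → A}

/-- A ternary operation commuting with the symbols of the language of acts. -/
def IsTernaryPolymorphism (S : Type u) {A : Type w} [(actLanguage S).Structure A]
    (m : A → A → A → A) : Prop :=
  ∀ (s : S) (x y z : A), m (Structure.funMap (actSymbol s) ![x])
    (Structure.funMap (actSymbol s) ![y]) (Structure.funMap (actSymbol s) ![z]) =
      Structure.funMap (actSymbol s) ![m x y z]

theorem IsTernaryPolymorphism.realize_term (hm : IsTernaryPolymorphism S m) {γ : Type*}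
    (t : (actLanguage S).Term γ) (v₁ v₂ v₃ : γ → A) :
    t.realize (fun i => m (v₁ i) (v₂ i) (v₃ i)) =
      m (t.realize v₁) (t.realize v₂) (t.realize v₃) := by
  induction t with
  | var i => rfl
  | func f ts ih =>
    cases f with
    | smul s =>
      have h (v : Fin 1 → A) : v = ![v 0] := by ext i; fin_cases i; rfl
      simp only [Term.realize]
      rw [h fun i => (ts i).realize v₁, h fun i => (ts i).realize v₂,
        h fun i => (ts i).realize v₃, h fun i => (ts i).realize _, ih]
      exact (hm s _ _ _).symm

theorem IsTernaryPolymorphism.realize_of_isAtomicConj (hm : IsTernaryPolymorphism S m)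
    {β : Type*} {k : ℕ} {φ : (actLanguage S).BoundedFormula β k} (hφ : IsAtomicConj φ)
    {v₁ v₂ v₃ : β → A} {x₁ x₂ x₃ : Fin k → A} (h₁ : φ.Realize v₁ x₁) (h₂ : φ.Realize v₂ x₂)
    (h₃ : φ.Realize v₃ x₃) :
    φ.Realize (fun i => m (v₁ i) (v₂ i) (v₃ i)) (fun i => m (x₁ i) (x₂ i) (x₃ i)) := by
  induction hφ with
  | atomic h =>
    cases h with
    | equal t₁ t₂ =>
      have hv : Sum.elim (fun i => m (v₁ i) (v₂ i) (v₃ i)) (fun i => m (x₁ i) (x₂ i) (x₃ i)) =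
          fun i => m (Sum.elim v₁ x₁ i) (Sum.elim v₂ x₂ i) (Sum.elim v₃ x₃ i) := by
        ext (i | i) <;> rfl
      simp only [BoundedFormula.realize_bdEqual] at h₁ h₂ h₃ ⊢
      rw [hv, hm.realize_term, hm.realize_term, h₁, h₂, h₃]
    | rel R _ => exact R.elim
  | and _ _ ih ih' =>
    rw [BoundedFormula.realize_inf] at *
    exact ⟨ih h₁.1 h₂.1 h₃.1, ih' h₁.2 h₂.2 h₃.2⟩

/-- Witnesses of the existential quantifiers are combined by `m` as well. -/
theorem IsTernaryPolymorphism.realize_of_isPrimitive (hm : IsTernaryPolymorphism S m)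
    {β : Type*} {k : ℕ} {φ : (actLanguage S).BoundedFormula β k} (hφ : IsPrimitive φ)
    {v₁ v₂ v₃ : β → A} {x₁ x₂ x₃ : Fin k → A} (h₁ : φ.Realize v₁ x₁) (h₂ : φ.Realize v₂ x₂)
    (h₃ : φ.Realize v₃ x₃) :
    φ.Realize (fun i => m (v₁ i) (v₂ i) (v₃ i)) (fun i => m (x₁ i) (x₂ i) (x₃ i)) := by
  induction hφ with
  | conj h => exact hm.realize_of_isAtomicConj h h₁ h₂ h₃
  | ex _ ih =>
    rw [BoundedFormula.realize_ex] at *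
    obtain ⟨a₁, h₁⟩ := h₁
    obtain ⟨a₂, h₂⟩ := h₂
    obtain ⟨a₃, h₃⟩ := h₃
    refine ⟨m a₁ a₂ a₃, ?_⟩
    convert ih h₁ h₂ h₃ using 1
    ext i
    refine Fin.lastCases ?_ (fun i => ?_) i <;> simp

theorem IsTernaryPolymorphism.subsingleton_of_isPrimitivelyDefinedOp
    (hm : IsTernaryPolymorphism S m) (hl : ∀ x y, m x x y = x) (ho : ∀ x y, m x y x = x)
    (hr : ∀ x y, m y x x = x) {n : ℕ} {B : Set (Fin n → A)}
    {α : (Fin n → A) → (Fin n → A) → Prop} [AddCommGroup (classesOf B α)]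
    (hop : IsPrimitivelyDefinedOp (actLanguage S) B α (fun p q => p + q)) :
    Subsingleton (classesOf B α) := by
  obtain ⟨k, φ, a, hφ, h⟩ := hop
  have hclass (p : classesOf B α) : ∃ (x : Fin n → A) (hx : x ∈ B), classOf α hx = p := by
    obtain ⟨_, x, hx, rfl⟩ := p
    exact ⟨x, hx, rfl⟩
  obtain ⟨o, ho', hoc⟩ := hclass 0
  refine subsingleton_of_forall_eq 0 fun p => ?_
  obtain ⟨x, hx, rfl⟩ := hclass p
  have h₁ := (h o x x ho' hx hx).2 (by simp [hoc])
  have h₂ := (h x o x hx ho' hx).2 (by simp [hoc])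
  have h₃ := (h o o o ho' ho' ho').2 (by simp [hoc])
  have key : φ.Realize (Sum.elim (Sum.elim (Sum.elim o o) x) a) := by
    have := hm.realize_of_isPrimitive hφ h₁ h₂ h₃
    unfold Formula.Realize
    convert this using 1
    · ext (((i | i) | i) | i) <;> simp [hl, ho, hr]
  simpa [hoc] using ((h o o x ho' ho' hx).1 key).symm

end Polymorphism

theorem mainTheorem2 {S : Type u} [CommMonoid S]
    (hax : IsAxiomatizableClass (regularActs.{u, u} S))
    (hpn : IsPrimitiveNormalClass (regularActs.{u, u} S)) :
    IsAntiadditiveClass (regularActs.{u, u} S) := by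
  refine ⟨hpn, fun M _ _ hM => ?_⟩
  rintro ⟨n, B, α, -, hinf, _, hop⟩
  obtain ⟨T, hT⟩ := hax
  -- The axioms `T` hold throughout the class, so they belong to its theory and hold in `M`.
  obtain ⟨-, _, hs, hreg⟩ := (hT ⟨M, inferInstance⟩).2
    ⟨‹_›, ⟨fun σ hσ => hM.realize_of_mem σ fun N hN => ((hT N).1 hN).2.realize_of_mem σ hσ⟩⟩
  choose e he he' using fun x : M => isActRegular_iff.1 (hreg x)
  have hc : IsIdempotentChoice e := ⟨he, he'⟩
  have hu := hasUniserialOrbits_of_isPrimitiveNormalClass hreg hpn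
  have hm : IsTernaryPolymorphism S (majority e) := fun s x y z => by
    simp only [hs]
    exact hc.majority_smul hu s x y z
  have := hm.subsingleton_of_isPrimitivelyDefinedOp hc.majority_left hc.majority_outer
    hc.majority_right hop
  exact hinf (Set.toFinite _)
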